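/- **Setting.** Let $\mathcal X$ be a finite set, $\Theta$ an arbitrary set, and let $\rho_\theta(x)$, for $\theta\in\Theta$ and $x\in\mathcal X$, be density matrices on a fixed finite-dimensional Hilbert space. Let $\mathcal M$ be the set of binary POVMs $M=\{M_0,M_1\}$ on that space ($M_c\ge 0$, $M_0+M_1=I$). For $\mathcal A\in\{\mathcal S,\mathcal T\}$ (source, target) let $p^{\mathcal A}$ be a probability distribution of $(c,x)\in\{0,1\}\times\mathcal X$ and $N^{\mathcal A}\ge 1$ an integer. Put $$\ell_{\theta,M}(c,x)=1-\mathrm{Tr}(M_c\rho_\theta(x)),\qquad \mathcal R^{\mathcal A}_{\theta,M}=\mathbb E_{p^{\mathcal A}}[\ell_{\theta,M}(c,x)],\qquad \mathcal R^{\mathcal A}_\theta=\min_{M\in\mathcal M}\mathcal R^{\mathcal A}_{\theta,M},$$ and, for a data set $\mathcal D^{\mathcal A}$ of $N^{\mathcal A}$ examples, $\widehat{\mathcal R}^{\mathcal A}_{\theta,M}=\frac1{N^{\mathcal A}}\sum_{(c,x)\in\mathcal D^{\mathcal A}}\ell_{\theta,M}(c,x)$. Assume that the following minimizers over $\Theta$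 exist: $\theta^{\mathcal A}_*\in\arg\min_{\theta}\mathcal R^{\mathcal A}_\theta$ for $\mathcal A\in\{\mathcal S,\mathcal T\}$ and, for every source data set, $\hat\theta=\hat\theta(\mathcal D^{\mathcal S})\in\arg\min_{\theta}\min_{M}\widehat{\mathcal R}^{\mathcal S}_{\theta,M}$. Let $\widehat M^{\mathcal T}_\theta=\widehat M^{\mathcal T}_\theta(\mathcal D^{\mathcal T})\in\arg\min_{M\in\mathcal M}\widehat{\mathcal R}^{\mathcal T}_{\theta,M}$ (a Helstrom measurement). The transfer excess risk is $$\Delta\mathcal R^{\mathcal S\to\mathcal T}=\mathcal R^{\mathcal T}_{\hat\theta,\widehat M^{\mathcal T}_{\hat\theta}}-\min_{\theta\in\Theta}\mathcal R^{\mathcal T}_\theta .$$ With $(c_j,x_j)$ i.i.d. from $p^{\mathcal A}$ and $\sigma_j$ independent uniform signs in $\{1,-1\}$, let $$\mathfrak R^{\mathcal A}_{\mathcal M}=\sup_{\theta\in\Theta}\mathbb E_{(c_j,x_j)_j}\mathbb E_{\sigma}\Big[\sup_{M\in\mathcal M}\sum_{j=1}^{N^{\mathcal A}}\frac{\sigma_j\ell_{\theta,M}(c_j,x_j)}{\sqrt{N^{\mathcal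 A}}}\Big],\qquad \mathfrak R^{\mathcal A}_{\Theta,\mathcal M}=\mathbb E_{(c_j,x_j)_j}\mathbb E_{\sigma}\Big[\sup_{\theta\in\Theta,\,M\in\mathcal M}\sum_{j=1}^{N^{\mathcal A}}\frac{\sigma_j\ell_{\theta,M}(c_j,x_j)}{\sqrt{N^{\mathcal A}}}\Big],$$ and let $I_2^{\mathcal A}(X;R_\theta)=2\log_2\mathrm{Tr}\sqrt{\sum_x p^{\mathcal A}(x)\rho_\theta(x)^2}$ be the 2-Rényi mutual information of the classical–quantum state $\sum_x p^{\mathcal A}(x)|x\rangle\langle x|\otimes\rho_\theta(x)$, where $p^{\mathcal A}(x)$ is the marginal of $p^{\mathcal A}$. **Theorem.** Let $D^{ST}\in\mathbb R$ be any constant such that $$|\mathcal R^{\mathcal T}_{\theta^{\mathcal T}_*}-\mathcal R^{\mathcal T}_{\theta}|\le|\mathcal R^{\mathcal S}_{\theta^{\mathcal S}_*}-\mathcal R^{\mathcal S}_{\theta}|+D^{ST}\qquad\text{for all }\theta\in\Theta,$$ and let $\delta\in(0,1)$. Then, with probability at least $1-\delta$ over independent data sets $\mathcal D^{\mathcal S}$,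 $\mathcal D^{\mathcal T}$ of $N^{\mathcal S}$ and $N^{\mathcal T}$ i.i.d. examples from $p^{\mathcal S}$ and $p^{\mathcal T}$ respectively, $$\Delta\mathcal R^{\mathcal S\to\mathcal T}\le\frac{4\,\mathfrak R^{\mathcal T}_{\mathcal M}}{\sqrt{N^{\mathcal T}}}+\sqrt{\frac{2}{N^{\mathcal T}}\log\frac3\delta}+D^{ST}+\frac{2(\mathfrak R^{\mathcal S}_{\Theta,\mathcal M}+\mathfrak R^{\mathcal S}_{\mathcal M})}{\sqrt{N^{\mathcal S}}}+\sqrt{\frac{2}{N^{\mathcal S}}\log\frac3\delta}.$$ Moreover, for $\mathcal A\in\{\mathcal S,\mathcal T\}$, $$\mathfrak R^{\mathcal A}_{\mathcal M}\le\frac12\sqrt{\sup_{\theta\in\Theta}2^{I_2^{\mathcal A}(X;R_\theta)}} .$$ -/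

import Mathlib

open MeasureTheory
open scoped MatrixOrder ComplexOrder

namespace QTransfer

noncomputable section

/-- A density matrix: a positive semidefinite complex matrix of unit trace on the
finite-dimensional Hilbert space with orthonormal basis indexed by `n`. -/
structure DensityMatrix (n : Type*) [Fintype n] where
  /-- the underlying matrix -/
  mat : Matrix n n ℂ
  posSemidef : mat.PosSemidef
  trace_eq_one : mat.trace = 1

/-- A binary POVM: a pair of positive semidefinite matrices `M₀, M₁` with `M₀ + M₁ = I`. -/
structure POVM (n : Type*) [Fintype n] [DecidableEq n] where
  /-- the two effects -/
  effect : Fin 2 → Matrix n n ℂ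
  posSemidef : ∀ c, (effect c).PosSemidef
  sum_eq_one : ∑ c, effect c = 1

variable {n X Θ : Type*} [Fintype n] [DecidableEq n]

/-- The loss `ℓ_{θ,M}(c,x) = 1 - Tr (M_c ρ_θ(x))` on the example `z = (c, x)`.
The trace of a product of two positive semidefinite matrices is real, so taking the real part
only changes its type. -/
def loss (ρ : Θ → X → DensityMatrix n) (θ : Θ) (M : POVM n) (z : Fin 2 × X) : ℝ :=
  1 - (M.effect z.1 * (ρ θ z.2).mat).trace.re

/-- The expected risk `R_{θ,M}` under the joint law `p` of `(c, x)`. -/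
def risk [MeasurableSpace X] (p : Measure (Fin 2 × X)) (ρ : Θ → X → DensityMatrix n)
    (θ : Θ) (M : POVM n) : ℝ :=
  ∫ z, loss ρ θ M z ∂p

/-- The minimum expected risk `R_θ = min_M R_{θ,M}`. -/
def minRisk [MeasurableSpace X] (p : Measure (Fin 2 × X)) (ρ : Θ → X → DensityMatrix n)
    (θ : Θ) : ℝ :=
  ⨅ M : POVM n, risk p ρ θ M

/-- The training loss of `(θ, M)` on the data set `D` of `N` examples. -/
def empRisk {N : ℕ} (D : Fin N → Fin 2 × X) (ρ : Θ → X → DensityMatrix n)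
    (θ : Θ) (M : POVM n) : ℝ :=
  (∑ j, loss ρ θ M (D j)) / N

/-- The minimum over all POVMs of the training loss at `θ`. -/
def minEmpRisk {N : ℕ} (D : Fin N → Fin 2 × X) (ρ : Θ → X → DensityMatrix n) (θ : Θ) : ℝ :=
  ⨅ M : POVM n, empRisk D ρ θ M

/-- The law of `N` i.i.d. examples drawn from `p`. -/
def iidLaw [MeasurableSpace X] (p : Measure (Fin 2 × X)) (N : ℕ) :
    Measure (Fin N → Fin 2 × X) :=
  Measure.pi fun _ => p

/-- The task-based distance `d(θ,θ') = |R_{θ'} - R_θ|` induced by the task with law `p`. -/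
def taskDist [MeasurableSpace X] (p : Measure (Fin 2 × X)) (ρ : Θ → X → DensityMatrix n)
    (θ θ' : Θ) : ℝ :=
  |minRisk p ρ θ' - minRisk p ρ θ|

/-- `d^T(θ, θ_*^T) ≤ d^S(θ, θ_*^S) + D` for all `θ`, where `θS` and `θT` stand for the optimal
embedding parameters `θ_*^S` and `θ_*^T` of the two tasks. -/
def Dissimilar [MeasurableSpace X] (pS pT : Measure (Fin 2 × X)) (ρ : Θ → X → DensityMatrix n)
    (θS θT : Θ) (DST : ℝ) : Prop :=
  ∀ θ, taskDist pT ρ θ θT ≤ taskDist pS ρ θ θS + DST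

/-- Expectation of `f σ` over `N` independent, equiprobable signs `σ_j ∈ {1, -1}`. -/
def signExpect (N : ℕ) (f : (Fin N → ℤˣ) → ℝ) : ℝ :=
  (∑ σ, f σ) / 2 ^ N

/-- `N^{-1/2} ∑_j σ_j ℓ_{θ,M}(c_j, x_j)`. -/
def signedLoss {N : ℕ} (ρ : Θ → X → DensityMatrix n) (D : Fin N → Fin 2 × X)
    (σ : Fin N → ℤˣ) (θ : Θ) (M : POVM n) : ℝ :=
  ∑ j, ((σ j : ℤ) : ℝ) * loss ρ θ M (D j) / √(N : ℝ)

/-- Rademacher complexity of the set of POVMs: the supremum is over `M` inside the expectation,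
and over `θ` outside. -/
def radPOVM [MeasurableSpace X] (p : Measure (Fin 2 × X)) (ρ : Θ → X → DensityMatrix n)
    (N : ℕ) : ℝ :=
  ⨆ θ : Θ, ∫ D, signExpect N (fun σ => ⨆ M : POVM n, signedLoss ρ D σ θ M) ∂(iidLaw p N)

/-- Joint Rademacher complexity of embeddings and POVMs: both suprema are inside. -/
def radJoint [MeasurableSpace X] (p : Measure (Fin 2 × X)) (ρ : Θ → X → DensityMatrix n)
    (N : ℕ) : ℝ :=
  ∫ D, signExpect N (fun σ => ⨆ q : Θ × POVM n, signedLoss ρ D σ q.1 q.2) ∂(iidLaw p N)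

/-- The 2-Rényi mutual information `I₂(X;R_θ) = 2 log₂ Tr √(∑_x p(x) ρ_θ(x)²)` of the
classical-quantum state `∑_x p(x) |x⟩⟨x| ⊗ ρ_θ(x)`, with `p(x)` the marginal law of `x`. -/
def renyiMI [Fintype X] [MeasurableSpace X] (p : Measure (Fin 2 × X))
    (ρ : Θ → X → DensityMatrix n) (θ : Θ) : ℝ :=
  2 * Real.logb 2
    (CFC.sqrt (∑ x, (p.snd.real {x} : ℂ) • ((ρ θ x).mat * (ρ θ x).mat))).trace.re

/-- The transfer excess risk `R^T_{θ,M} - min_θ' R^T_θ'` of a pair `(θ, M)`. -/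
def transferExcess [MeasurableSpace X] (pT : Measure (Fin 2 × X))
    (ρ : Θ → X → DensityMatrix n) (θ : Θ) (M : POVM n) : ℝ :=
  risk pT ρ θ M - ⨅ θ' : Θ, minRisk pT ρ θ'

end

end QTransfer

open QTransfer

/-! The excess risk splits into the cost of training the POVM at the learned embedding $\hat\theta$
and the gap $\mathcal R^T_{\hat\theta}-\mathcal R^T_{\theta_*^T}$, which the dissimilarity
hypothesis moves to the source task. Both costs come from one deviation bound
(`measureReal_pi_deviation_le`): McDiarmid's inequality concentrates a sum of two one-sided uniform
deviations, and symmetrization bounds its mean by Rademacher complexities.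

On the source, the true risk must be controlled uniformly in $(\theta,M)$ because $\hat\theta$ is
random, but the reverse gap only at the fixed $\theta_*^S$; hence the joint complexity plus the POVM
one. On the target, independence freezes $\hat\theta$, so bounds at each fixed $\theta$ suffice, and
the supremum over $\theta$ may stay outside the expectation.

For the Rényi bound, the loss depends on $M$ only through $\mathrm{Tr}((M_0-M_1)\rho)$. With $B$ the
signed sum of states over $\sqrt N$, a weighted AM-GM inequality gives
$2\,\mathrm{Tr}(AB)\le\mathrm{Tr}\,Q+\mathrm{Tr}(Q^{-1}B^2)$ for $A^2\le 1$. As $Q$ is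
deterministic, averaging replaces $B^2$ by $S=\sum_x p(x)\rho(x)^2$, and $Q\approx\sqrt S$ is the
right choice. No operator Jensen inequality is needed. -/

namespace QTransfer

/-! ### McDiarmid's inequality. -/

section Concentration

open ProbabilityTheory

variable {Z : Type*} [Fintype Z] [MeasurableSpace Z] [MeasurableSingletonClass Z]
  (p : Measure Z) [IsProbabilityMeasure p]

theorem integral_pi_succ {N : ℕ} (f : (Fin (N + 1) → Z) → ℝ) :
    ∫ D, f D ∂(Measure.pi fun _ => p) =
      ∫ z, ∫ w, f (Fin.cons z w) ∂(Measure.pi fun _ => p) ∂p := by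
  have h := (measurePreserving_piFinSuccAbove (fun _ : Fin (N + 1) => p) 0).symm
  rw [← h.integral_comp', integral_prod _ Integrable.of_finite]
  simp [MeasurableEquiv.piFinSuccAbove, Fin.insertNthEquiv]

/-- Hoeffding's lemma: the values of `f` fill an interval of length at most `c` above its minimum.
-/
theorem integral_exp_sub_le_of_forall_le_add {f : Z → ℝ} {c : ℝ}
    (hf : ∀ z z', f z ≤ f z' + c) (t : ℝ) :
    ∫ z, Real.exp (t * (f z - ∫ z', f z' ∂p)) ∂p ≤ Real.exp (c ^ 2 * t ^ 2 / 8) := by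
  have : Nonempty Z := nonempty_of_isProbabilityMeasure p
  obtain ⟨a, ha⟩ := Finite.exists_min f (α := Z)
  have h := hasSubgaussianMGF_of_mem_Icc (μ := p) (X := f) (a := f a) (b := f a + c)
    (measurable_of_finite f).aemeasurable (ae_of_all _ fun z => ⟨ha z, hf z a⟩)
  refine (h.mgf_le t).trans_eq ?_
  congr 1
  simp only [add_sub_cancel_left, NNReal.coe_pow, NNReal.coe_div, coe_nnnorm, NNReal.coe_ofNat,
    div_pow, Real.norm_eq_abs, sq_abs]
  ring

/-- The moment generating function bound behind McDiarmid's inequality. -/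
theorem integral_exp_sub_pi_le {c : ℝ} (t : ℝ) : ∀ {N : ℕ} {f : (Fin N → Z) → ℝ},
    (∀ D k z, f (Function.update D k z) ≤ f D + c) →
    ∫ D, Real.exp (t * (f D - ∫ D', f D' ∂(Measure.pi fun _ => p))) ∂(Measure.pi fun _ => p) ≤
      Real.exp (N * (c ^ 2 * t ^ 2 / 8))
  | 0, f, _ => by
    have h : ∀ D, f D = f Fin.elim0 := fun D => congrArg f (Subsingleton.elim _ _)
    simp [h]
  | N + 1, f, hf => by
    set μ : Measure (Fin N → Z) := Measure.pi fun _ => p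
    -- Conditional mean given the first example. It inherits oscillation at most `c`, so Hoeffding's
    -- lemma handles it and induction handles the fluctuation around it.
    set g : Z → ℝ := fun z => ∫ w, f (Fin.cons z w) ∂μ with hg
    have hgc : ∀ z z', g z ≤ g z' + c := fun z z' => by
      have : ∀ w, f (Fin.cons z w) ≤ f (Fin.cons z' w) + c := fun w => by
        simpa [Fin.update_cons_zero] using hf (Fin.cons z' w) 0 z
      calc g z ≤ ∫ w, (f (Fin.cons z' w) + c) ∂μ :=
            integral_mono Integrable.of_finite Integrable.of_finite this
        _ = g z' + c := by rw [integral_add Integrable.of_finite Integrable.of_finite]; simp [hg]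
    have hin : ∀ z, ∫ w, Real.exp (t * (f (Fin.cons z w) - g z)) ∂μ ≤
        Real.exp (N * (c ^ 2 * t ^ 2 / 8)) := fun z =>
      integral_exp_sub_pi_le t fun D k z' => by
        simpa only [Fin.cons_update] using hf (Fin.cons z D) k.succ z'
    rw [integral_pi_succ p f, integral_pi_succ]
    calc ∫ z, ∫ w, Real.exp (t * (f (Fin.cons z w) - ∫ z, g z ∂p)) ∂μ ∂p
        = ∫ z, Real.exp (t * (g z - ∫ z, g z ∂p)) *
            ∫ w, Real.exp (t * (f (Fin.cons z w) - g z)) ∂μ ∂p := by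
          refine integral_congr_ae (ae_of_all _ fun z => ?_)
          simp only
          rw [← integral_const_mul]
          refine integral_congr_ae (ae_of_all _ fun w => ?_)
          simp only
          rw [← Real.exp_add]
          ring_nf
      _ ≤ ∫ z, Real.exp (t * (g z - ∫ z, g z ∂p)) * Real.exp (N * (c ^ 2 * t ^ 2 / 8)) ∂p :=
          integral_mono Integrable.of_finite Integrable.of_finite fun z =>
            mul_le_mul_of_nonneg_left (hin z) (Real.exp_pos _).le
      _ = (∫ z, Real.exp (t * (g z - ∫ z, g z ∂p)) ∂p) * Real.exp (N * (c ^ 2 * t ^ 2 / 8)) :=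
          integral_mul_const _ _
      _ ≤ Real.exp (c ^ 2 * t ^ 2 / 8) * Real.exp (N * (c ^ 2 * t ^ 2 / 8)) :=
          mul_le_mul_of_nonneg_right (integral_exp_sub_le_of_forall_le_add p hgc t)
            (Real.exp_pos _).le
      _ = Real.exp ((N + 1 : ℕ) * (c ^ 2 * t ^ 2 / 8)) := by
          rw [← Real.exp_add]; push_cast; ring_nf

/-- **McDiarmid's inequality** on a finite sample space. -/
theorem measureReal_pi_ge_le_of_bounded_differences {c ε : ℝ} (hε : 0 ≤ ε) {N : ℕ}
    {f : (Fin N → Z) → ℝ} (hf : ∀ D k z, f (Function.update D k z) ≤ f D + c) :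
    (Measure.pi fun _ => p).real {D | (∫ D', f D' ∂(Measure.pi fun _ => p)) + ε ≤ f D} ≤
      Real.exp (-(2 * ε ^ 2) / (N * c ^ 2)) := by
  -- The variance proxy is $Nc^2/4$ because $N c^2t^2/8=(Nc^2/4)\,t^2/2$.
  have h : HasSubgaussianMGF (fun D => f D - ∫ D', f D' ∂(Measure.pi fun _ => p))
      (Real.toNNReal (N * c ^ 2 / 4)) (Measure.pi fun _ => p) := by
    refine ⟨fun t => Integrable.of_finite, fun t => (integral_exp_sub_pi_le p t hf).trans_eq ?_⟩
    rw [Real.coe_toNNReal _ (by positivity)]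
    ring_nf
  refine le_trans (le_of_eq ?_) ((h.measure_ge_le hε).trans_eq ?_)
  · congr 1
    ext D
    simp only [Set.mem_ofPred_eq]
    constructor <;> intro h <;> linarith
  · rw [Real.coe_toNNReal _ (by positivity)]
    congr 1
    rw [show 2 * ((N : ℝ) * c ^ 2 / 4) = N * c ^ 2 / 2 by ring, div_div_eq_mul_div]
    ring

end Concentration

/-! ### Sign averages and Rademacher complexity. -/

section Rademacher

variable {Z ι : Type*}

theorem bddAbove_range_sum_mul {N : ℕ} {ℓ : ι → Z → ℝ} (hℓ : ∀ i z, |ℓ i z| ≤ 1)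
    (a : Fin N → ℝ) (D : Fin N → Z) : BddAbove (Set.range fun i => ∑ j, a j * ℓ i (D j)) := by
  refine ⟨∑ j, |a j|, ?_⟩
  rintro _ ⟨i, rfl⟩
  refine Finset.sum_le_sum fun j _ => (le_abs_self _).trans ?_
  rw [abs_mul]
  exact mul_le_of_le_one_right (abs_nonneg _) (hℓ i _)

theorem ciSup_le_ciSup_add [Nonempty ι] {f g : ι → ℝ} {c : ℝ} (hg : BddAbove (Set.range g))
    (h : ∀ i, f i ≤ g i + c) : ⨆ i, f i ≤ (⨆ i, g i) + c :=
  ciSup_le fun i => (h i).trans (by gcongr; exact le_ciSup hg i)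

/-- The sign expectation is invariant under flipping a fixed set of signs. -/
theorem signExpect_mul_left {N : ℕ} (s : Fin N → ℤˣ) (f : (Fin N → ℤˣ) → ℝ) :
    signExpect N (fun σ => f (s * σ)) = signExpect N f := by
  unfold signExpect
  rw [Fintype.sum_equiv (Equiv.mulLeft s) (fun σ => f (s * σ)) f fun σ => rfl]

theorem signExpect_const (N : ℕ) (a : ℝ) : signExpect N (fun _ => a) = a := by
  simp [signExpect, Fintype.card_units_int]

theorem signExpect_add {N : ℕ} (f g : (Fin N → ℤˣ) → ℝ) :
    signExpect N (fun σ => f σ + g σ) = signExpect N f + signExpect N g := by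
  simp [signExpect, Finset.sum_add_distrib, add_div]

theorem signExpect_mono {N : ℕ} {f g : (Fin N → ℤˣ) → ℝ} (h : ∀ σ, f σ ≤ g σ) :
    signExpect N f ≤ signExpect N g := by
  unfold signExpect
  gcongr
  exact h _

theorem signExpect_const_mul {N : ℕ} (a : ℝ) (f : (Fin N → ℤˣ) → ℝ) :
    signExpect N (fun σ => a * f σ) = a * signExpect N f := by
  simp [signExpect, ← Finset.mul_sum, mul_div_assoc]

/-- The (unnormalised) Rademacher complexity of a class of functions. -/
noncomputable def rademacher [MeasurableSpace Z] (p : Measure Z) (N : ℕ) (ℓ : ι → Z → ℝ) : ℝ :=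
  ∫ D, signExpect N (fun σ => ⨆ i, ∑ j, ((σ j : ℤ) : ℝ) * ℓ i (D j)) ∂(Measure.pi fun _ => p)

theorem rademacher_neg [MeasurableSpace Z] (p : Measure Z) (N : ℕ) (ℓ : ι → Z → ℝ) :
    rademacher p N (fun i z => -ℓ i z) = rademacher p N ℓ := by
  unfold rademacher
  refine integral_congr_ae (ae_of_all _ fun D => ?_)
  simp only
  rw [← signExpect_mul_left (-1)]
  simp

end Rademacher

/-! ### Symmetrization with a ghost sample. -/

section Symmetrization

variable {Z ι : Type*} [Fintype Z] [MeasurableSpace Z] [MeasurableSingletonClass Z]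
  (p : Measure Z) [IsProbabilityMeasure p]

theorem integral_pi_eq_sum {N : ℕ} (f : (Fin N → Z) → ℝ) :
    ∫ D, f D ∂(Measure.pi fun _ => p) = ∑ D, (∏ j, p.real {D j}) * f D := by
  classical
  rw [integral_fintype Integrable.of_finite]
  refine Finset.sum_congr rfl fun D _ => ?_
  rw [smul_eq_mul, measureReal_def, Measure.pi_singleton, ENNReal.toReal_prod]
  rfl

theorem integral_pi_comp_eval {N : ℕ} (f : Z → ℝ) (j : Fin N) :
    ∫ D, f (D j) ∂(Measure.pi fun _ => p) = ∫ z, f z ∂p :=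
  (integral_map (μ := Measure.pi fun _ => p) (φ := Function.eval j)
    (measurable_pi_apply j).aemeasurable
    (measurable_of_finite f).aestronglyMeasurable).symm.trans
    (by rw [(measurePreserving_eval (fun _ : Fin N => p) j).map_eq])

/-- Exchangeability: two independent samples may be swapped coordinatewise. -/
theorem integral_pi_pi_swap {N : ℕ} (s : Fin N → Prop) [DecidablePred s]
    (f : (Fin N → Z) → (Fin N → Z) → ℝ) :
    ∫ D, ∫ D', f (fun j => if s j then D j else D' j) (fun j => if s j then D' j else D j)
        ∂(Measure.pi fun _ => p) ∂(Measure.pi fun _ => p) =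
      ∫ D, ∫ D', f D D' ∂(Measure.pi fun _ => p) ∂(Measure.pi fun _ => p) := by
  simp only [integral_pi_eq_sum, Finset.mul_sum, ← mul_assoc, ← Finset.prod_mul_distrib]
  rw [← Fintype.sum_prod_type', ← Fintype.sum_prod_type']
  -- The exchange is an involution on pairs of samples that preserves the product weight.
  let e : (Fin N → Z) × (Fin N → Z) → (Fin N → Z) × (Fin N → Z) := fun q =>
    (fun j => if s j then q.1 j else q.2 j, fun j => if s j then q.2 j else q.1 j)
  have he : Function.Involutive e := fun q => by
    refine Prod.ext (funext fun j => ?_) (funext fun j => ?_) <;> by_cases h : s j <;> simp [e, h]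
  refine Fintype.sum_equiv he.toPerm _ _ fun q => ?_
  simp only [Function.Involutive.coe_toPerm, e]
  congr 1
  refine Finset.prod_congr rfl fun j _ => ?_
  by_cases h : s j <;> simp [h, mul_comm]

theorem integral_signExpect {N : ℕ} (f : (Fin N → ℤˣ) → (Fin N → Z) → ℝ) :
    ∫ D, signExpect N (fun σ => f σ D) ∂(Measure.pi fun _ => p) =
      signExpect N (fun σ => ∫ D, f σ D ∂(Measure.pi fun _ => p)) := by
  unfold signExpect
  rw [integral_div, integral_finsetSum _ fun _ _ => Integrable.of_finite]

/-- **Symmetrization**: the expected uniform deviation is at most twice the Rademacher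
complexity. -/
theorem integral_ciSup_sub_le_rademacher [Nonempty ι] {N : ℕ} {ℓ : ι → Z → ℝ}
    (hℓ : ∀ i z, |ℓ i z| ≤ 1) :
    ∫ D : Fin N → Z, (⨆ i, (N * ∫ z, ℓ i z ∂p - ∑ j, ℓ i (D j))) ∂(Measure.pi fun _ => p) ≤
      2 * rademacher p N ℓ := by
  set μ : Measure (Fin N → Z) := Measure.pi fun _ => p with hμ
  have hb := fun (a : Fin N → ℝ) (D : Fin N → Z) => bddAbove_range_sum_mul hℓ a D
  have hsup : ∀ (a b : Fin N → ℝ) (D D' : Fin N → Z),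
      (⨆ i, (∑ j, a j * ℓ i (D j) + ∑ j, b j * ℓ i (D' j))) ≤
        (⨆ i, ∑ j, a j * ℓ i (D j)) + ⨆ i, ∑ j, b j * ℓ i (D' j) := fun a b D D' =>
    ciSup_le fun i => add_le_add (le_ciSup (f := fun i => ∑ j, a j * ℓ i (D j)) (hb a D) i)
      (le_ciSup (f := fun i => ∑ j, b j * ℓ i (D' j)) (hb b D') i)
  have hbdd : ∀ (a b : Fin N → ℝ) (D D' : Fin N → Z),
      BddAbove (Set.range fun i => ∑ j, a j * ℓ i (D j) + ∑ j, b j * ℓ i (D' j)) :=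
    fun a b D D' => ⟨(⨆ i, ∑ j, a j * ℓ i (D j)) + ⨆ i, ∑ j, b j * ℓ i (D' j), by
      rintro _ ⟨i, rfl⟩
      exact add_le_add (le_ciSup (f := fun i => ∑ j, a j * ℓ i (D j)) (hb a D) i)
        (le_ciSup (f := fun i => ∑ j, b j * ℓ i (D' j)) (hb b D') i)⟩
  -- The mean is an expectation over a ghost sample `D'`; the supremum of an integral is at most the
  -- integral of the supremum.
  have hghost : ∀ D : Fin N → Z, (⨆ i, (N * ∫ z, ℓ i z ∂p - ∑ j, ℓ i (D j))) ≤
      ∫ D' : Fin N → Z, (⨆ i, (∑ j, (1 : ℝ) * ℓ i (D' j) + ∑ j, (-1 : ℝ) * ℓ i (D j))) ∂μ :=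
      fun D => by
    refine ciSup_le fun i => ?_
    have : N * ∫ z, ℓ i z ∂p - ∑ j, ℓ i (D j) =
        ∫ D' : Fin N → Z, (∑ j, (1 : ℝ) * ℓ i (D' j) + ∑ j, (-1 : ℝ) * ℓ i (D j)) ∂μ := by
      rw [integral_add Integrable.of_finite Integrable.of_finite,
        integral_finsetSum _ fun _ _ => Integrable.of_finite]
      simp [integral_pi_comp_eval, hμ, sub_eq_add_neg]
    rw [this]
    exact integral_mono Integrable.of_finite Integrable.of_finite fun D' =>
      le_ciSup (hbdd (fun _ => 1) (fun _ => -1) D' D) i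
  have hswap : ∀ σ : Fin N → ℤˣ,
      ∫ D : Fin N → Z, ∫ D' : Fin N → Z,
        (⨆ i, (∑ j, (1 : ℝ) * ℓ i (D' j) + ∑ j, (-1 : ℝ) * ℓ i (D j))) ∂μ ∂μ =
      ∫ D : Fin N → Z, ∫ D' : Fin N → Z,
        (⨆ i, (∑ j, ((σ j : ℤ) : ℝ) * ℓ i (D' j) +
        ∑ j, ((-σ j : ℤ) : ℝ) * ℓ i (D j))) ∂μ ∂μ := fun σ => by
    -- The two samples are exchanged exactly where $\sigma_j=-1$, which turns the coefficients
    -- $\pm1$ into $\pm\sigma_j$.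
    rw [← integral_pi_pi_swap p (fun j => σ j = 1)]
    refine integral_congr_ae (ae_of_all _ fun D => integral_congr_ae (ae_of_all _ fun D' => ?_))
    simp only [← Finset.sum_add_distrib]
    refine iSup_congr fun i => Finset.sum_congr rfl fun j _ => ?_
    rcases Int.units_eq_one_or (σ j) with h | h <;> simp [h, add_comm]
  calc ∫ D : Fin N → Z, (⨆ i, (N * ∫ z, ℓ i z ∂p - ∑ j, ℓ i (D j))) ∂μ
      ≤ ∫ D : Fin N → Z, ∫ D' : Fin N → Z,
        (⨆ i, (∑ j, (1 : ℝ) * ℓ i (D' j) + ∑ j, (-1 : ℝ) * ℓ i (D j))) ∂μ ∂μ :=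
        integral_mono Integrable.of_finite Integrable.of_finite hghost
    _ = signExpect N (fun σ => ∫ D : Fin N → Z, ∫ D' : Fin N → Z,
        (⨆ i, (∑ j, ((σ j : ℤ) : ℝ) * ℓ i (D' j) +
        ∑ j, ((-σ j : ℤ) : ℝ) * ℓ i (D j))) ∂μ ∂μ) := by
        rw [← signExpect_const N (∫ D : Fin N → Z, ∫ D' : Fin N → Z,
        _ ∂μ ∂μ)]
        congr 1
        exact funext hswap
    _ ≤ signExpect N (fun σ => ∫ D : Fin N → Z, (⨆ i, ∑ j, ((σ j : ℤ) : ℝ) * ℓ i (D j)) ∂μ +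
        ∫ D : Fin N → Z, (⨆ i, ∑ j, ((((-1 : Fin N → ℤˣ) * σ) j : ℤ) : ℝ) * ℓ i (D j)) ∂μ) := by
        refine signExpect_mono fun σ => ?_
        calc _ ≤ ∫ D : Fin N → Z, ∫ D' : Fin N → Z,
        ((⨆ i, ∑ j, ((σ j : ℤ) : ℝ) * ℓ i (D' j)) +
              ⨆ i, ∑ j, ((-σ j : ℤ) : ℝ) * ℓ i (D j)) ∂μ ∂μ :=
              integral_mono Integrable.of_finite Integrable.of_finite fun D =>
                integral_mono Integrable.of_finite Integrable.of_finite fun D' =>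
                  hsup _ _ D' D
          _ = _ := by
              simp only [integral_add Integrable.of_finite Integrable.of_finite]
              simp
    _ = 2 * rademacher p N ℓ := by
        rw [signExpect_add, signExpect_mul_left (-1)
          (fun σ => ∫ D : Fin N → Z, (⨆ i, ∑ j, ((σ j : ℤ) : ℝ) * ℓ i (D j)) ∂μ),
          ← integral_signExpect]
        unfold rademacher
        ring

end Symmetrization

/-! ### Trace inequalities. -/

section Trace

open Matrix

variable {n : Type*} [Fintype n]

theorem trace_mul_re_nonneg [DecidableEq n] {A B : Matrix n n ℂ} (hA : A.PosSemidef)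
    (hB : B.PosSemidef) : 0 ≤ (A * B).trace.re := by
  obtain ⟨C, rfl⟩ := CStarAlgebra.nonneg_iff_eq_star_mul_self.mp hB.nonneg
  rw [← mul_assoc, trace_mul_comm, ← mul_assoc]
  exact (Complex.le_def.mp (hA.mul_mul_conjTranspose_same C).trace_nonneg).1

/-- Nonnegative $2\times2$ principal minors give $A_{ij}A_{ji}\le A_{ii}A_{jj}$; sum over $i,j$. -/
theorem trace_sq_re_le_sq_trace {A : Matrix n n ℂ} (hA : A.PosSemidef) :
    (A * A).trace.re ≤ A.trace.re ^ 2 := by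
  have h : ∀ i j, (A i j * A j i).re ≤ (A i i).re * (A j j).re := fun i j => by
    have hd := (hA.submatrix ![i, j]).det_nonneg
    rw [det_fin_two] at hd
    have h1 := (Complex.le_def.mp (hA.diag_nonneg (i := i))).2
    have h2 := (Complex.le_def.mp hd).1
    simp [Complex.mul_re] at h1 h2 ⊢
    rw [← h1] at h2
    linarith
  rw [sq, trace, trace, Complex.re_sum, Complex.re_sum, Finset.sum_mul_sum]
  refine Finset.sum_le_sum fun i _ => ?_
  rw [diag_apply, mul_apply, Complex.re_sum]
  exact Finset.sum_le_sum fun j _ => h i j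

variable [DecidableEq n]

/-- Weighted AM-GM: expand $\mathrm{Tr}\,(AQ-B)Q^{-1}(AQ-B)^*\ge0$. -/
theorem two_mul_trace_mul_le {A B Q : Matrix n n ℂ} (hA : A.IsHermitian) (hB : B.IsHermitian)
    (hQ : Q.PosDef) :
    2 * (A * B).trace.re ≤ (Q * (A * A)).trace.re + (Q⁻¹ * (B * B)).trace.re := by
  have hdet : IsUnit Q.det := (isUnit_iff_isUnit_det Q).mp hQ.isUnit
  have h := (hQ.inv.posSemidef.mul_mul_conjTranspose_same (A * Q - B)).trace_nonneg
  have he : (A * Q - B) * Q⁻¹ * (A * Q - B)ᴴ = A * Q * A - A * B - B * A + B * Q⁻¹ * B := by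
    rw [conjTranspose_sub, conjTranspose_mul, hA.eq, hB.eq, hQ.isHermitian.eq, sub_mul, mul_assoc A,
      mul_nonsing_inv _ hdet, mul_one, sub_mul, mul_sub, mul_sub, ← mul_assoc (B * Q⁻¹),
      mul_assoc B Q⁻¹ Q, nonsing_inv_mul _ hdet, mul_one, ← mul_assoc]
    abel
  rw [he] at h
  have h1 := (Complex.le_def.mp h).1
  rw [trace_add, trace_sub, trace_sub, trace_mul_comm B A, mul_assoc A, trace_mul_comm A,
    mul_assoc Q, mul_assoc B, trace_mul_comm B, mul_assoc Q⁻¹] at h1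
  simp only [Complex.zero_re, Complex.add_re, Complex.sub_re] at h1
  linarith

/-- For an observable `A` with `A² ≤ 1`. -/
theorem two_mul_trace_mul_le_of_sq_le_one {A B Q : Matrix n n ℂ} (hA : A.IsHermitian)
    (hA1 : (1 - A * A).PosSemidef) (hB : B.IsHermitian) (hQ : Q.PosDef) :
    2 * (A * B).trace.re ≤ Q.trace.re + (Q⁻¹ * (B * B)).trace.re := by
  have h := trace_mul_re_nonneg hQ.posSemidef hA1
  rw [mul_sub, mul_one, trace_sub, Complex.sub_re] at h
  linarith [two_mul_trace_mul_le hA hB hQ]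

theorem trace_inv_add_smul_one_mul_sq_le {P : Matrix n n ℂ} (hP : P.PosSemidef) {ε : ℝ}
    (hε : 0 < ε) : ((P + (ε : ℂ) • 1)⁻¹ * (P * P)).trace.re ≤ P.trace.re := by
  have hQ : (P + (ε : ℂ) • 1).PosDef := by
    refine PosDef.posSemidef_add hP (PosDef.one.smul ?_)
    exact_mod_cast hε
  have hdet := (isUnit_iff_isUnit_det _).mp hQ.isUnit
  have h := trace_mul_re_nonneg hQ.inv.posSemidef hP
  have he : (P + (ε : ℂ) • 1)⁻¹ * (P * P) = P - (ε : ℂ) • ((P + (ε : ℂ) • 1)⁻¹ * P) := by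
    -- Cancelling the inverse leaves $P$ minus $\varepsilon$ times a product of positive matrices,
    -- whose trace is nonnegative.
    have : P * P = (P + (ε : ℂ) • 1) * P - (ε : ℂ) • P := by simp [add_mul]
    rw [this, mul_sub, ← mul_assoc, nonsing_inv_mul _ hdet, one_mul, mul_smul_comm]
  rw [he, trace_sub, trace_smul, Complex.sub_re, smul_eq_mul, Complex.re_ofReal_mul]
  linarith [mul_nonneg hε.le h]

/-- `2 Tr √S ≤ Tr S + dim`. -/
theorem two_mul_trace_sqrt_le {S : Matrix n n ℂ} (hS : S.PosSemidef) :
    2 * (CFC.sqrt S).trace.re ≤ S.trace.re + Fintype.card n := by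
  have hP : (CFC.sqrt S).IsHermitian := (CFC.sqrt_nonneg S).posSemidef.isHermitian
  -- Expand $\mathrm{Tr}(\sqrt S-1)^2\ge0$.
  have h := (posSemidef_conjTranspose_mul_self (CFC.sqrt S - 1)).trace_nonneg
  rw [conjTranspose_sub, hP.eq, conjTranspose_one, sub_mul, mul_sub, CFC.sqrt_mul_sqrt_self S
    hS.nonneg] at h
  have h1 := (Complex.le_def.mp h).1
  simp [trace_sub] at h1
  linarith

end Trace

/-! ### Binary observables and the loss. -/

section POVM

open Matrix

variable {n : Type*} [Fintype n] [DecidableEq n]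

instance : Nonempty (POVM n) :=
  ⟨⟨![1, 0], fun c => by fin_cases c; exacts [PosSemidef.one, PosSemidef.zero], by simp⟩⟩

theorem POVM.effect_one (M : POVM n) : M.effect 1 = 1 - M.effect 0 := by
  rw [← M.sum_eq_one, Fin.sum_univ_two, add_sub_cancel_left]

/-- The binary observable `M₀ - M₁`. -/
def POVM.observable (M : POVM n) : Matrix n n ℂ := M.effect 0 - M.effect 1

theorem POVM.isHermitian_observable (M : POVM n) : M.observable.IsHermitian :=
  (M.posSemidef 0).isHermitian.sub (M.posSemidef 1).isHermitian

theorem POVM.posSemidef_one_sub_observable_sq (M : POVM n) :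
    (1 - M.observable * M.observable).PosSemidef := by
  -- The effects commute, so this is $4M_0M_1$; writing it as $4(M_0M_1M_0+M_1M_0M_1)$ makes
  -- positivity visible.
  have h : 1 - M.observable * M.observable =
      (4 : ℂ) • ((M.effect 0)ᴴ * M.effect 1 * M.effect 0 +
        (M.effect 1)ᴴ * M.effect 0 * M.effect 1) := by
    rw [(M.posSemidef 0).isHermitian.eq, (M.posSemidef 1).isHermitian.eq, observable,
      M.effect_one, ofNat_smul_eq_nsmul]
    noncomm_ring
  rw [h]
  exact (((M.posSemidef 1).conjTranspose_mul_mul_same _).add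
    ((M.posSemidef 0).conjTranspose_mul_mul_same _)).smul (by norm_num)

/-- The sign `(-1)^c` of a label. -/
def labelSign (c : Fin 2) : ℤˣ := if c = 0 then 1 else -1

variable {X Θ : Type*} (ρ : Θ → X → DensityMatrix n)

theorem loss_nonneg (θ : Θ) (M : POVM n) (z : Fin 2 × X) : 0 ≤ loss ρ θ M z := by
  have h1 : (1 - M.effect z.1).PosSemidef := by
    rw [← M.sum_eq_one, Fin.sum_univ_two]
    rcases z with ⟨c, x⟩
    fin_cases c
    · simpa using M.posSemidef 1
    · simpa using M.posSemidef 0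
  have h := trace_mul_re_nonneg h1 (ρ θ z.2).posSemidef
  rwa [sub_mul, one_mul, trace_sub, (ρ θ z.2).trace_eq_one] at h

theorem loss_le_one (θ : Θ) (M : POVM n) (z : Fin 2 × X) : loss ρ θ M z ≤ 1 :=
  sub_le_self _ (trace_mul_re_nonneg (M.posSemidef z.1) (ρ θ z.2).posSemidef)

theorem loss_eq_observable (θ : Θ) (M : POVM n) (z : Fin 2 × X) :
    loss ρ θ M z = 1 / 2 -
      ((labelSign z.1 : ℤ) : ℝ) * (M.observable * (ρ θ z.2).mat).trace.re / 2 := by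
  rcases z with ⟨c, x⟩
  have h := (ρ θ x).trace_eq_one
  fin_cases c <;>
  · simp [loss, labelSign, POVM.observable, M.effect_one, sub_mul, trace_sub, h]
    ring

end POVM

/-! ### Second moments of random signs. -/

section Signs

theorem signExpect_sum {N : ℕ} {ι : Type*} (s : Finset ι) (f : ι → (Fin N → ℤˣ) → ℝ) :
    signExpect N (fun σ => ∑ i ∈ s, f i σ) = ∑ i ∈ s, signExpect N (f i) := by
  unfold signExpect
  rw [Finset.sum_comm, Finset.sum_div]

theorem signExpect_sign {N : ℕ} (j : Fin N) : signExpect N (fun σ => ((σ j : ℤ) : ℝ)) = 0 := by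
  have h := signExpect_mul_left (-1) (fun σ : Fin N → ℤˣ => ((σ j : ℤ) : ℝ))
  have h2 := signExpect_const_mul (-1) (fun σ : Fin N → ℤˣ => ((σ j : ℤ) : ℝ))
  simp only [Pi.mul_apply, Pi.neg_apply, Pi.one_apply, neg_mul, one_mul, Units.val_neg,
    Int.cast_neg] at h h2
  linarith

theorem signExpect_sign_mul_sign {N : ℕ} (j k : Fin N) :
    signExpect N (fun σ => ((σ j : ℤ) : ℝ) * ((σ k : ℤ) : ℝ)) = if j = k then 1 else 0 := by
  split_ifs with hjk
  · subst hjk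
    rw [← signExpect_const N 1]
    congr 1
    funext σ
    rcases Int.units_eq_one_or (σ j) with h | h <;> simp [h]
  -- Flipping $\sigma_j$ alone negates the product, so its mean is zero.
  · have h := signExpect_mul_left (Pi.mulSingle j (-1))
      (fun σ : Fin N → ℤˣ => ((σ j : ℤ) : ℝ) * ((σ k : ℤ) : ℝ))
    have h2 := signExpect_const_mul (-1)
      (fun σ : Fin N → ℤˣ => ((σ j : ℤ) : ℝ) * ((σ k : ℤ) : ℝ))
    simp only [Pi.mul_apply, Pi.mulSingle_eq_same, Pi.mulSingle_eq_of_ne (Ne.symm hjk), neg_mul,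
      one_mul, Units.val_neg, Int.cast_neg] at h h2
    linarith

theorem signExpect_quadratic {N : ℕ} (a : Fin N → Fin N → ℝ) :
    signExpect N (fun σ => ∑ j, ∑ k, a j k * (((σ j : ℤ) : ℝ) * ((σ k : ℤ) : ℝ))) =
      ∑ j, a j j := by
  simp [signExpect_sum, signExpect_const_mul, signExpect_sign_mul_sign]

end Signs

/-! ### Rényi bound on the POVM complexity. -/

section Renyi

open Matrix

variable {n X Θ : Type*} [Fintype n] (ρ : Θ → X → DensityMatrix n)

theorem DensityMatrix.posSemidef_sq (r : DensityMatrix n) : (r.mat * r.mat).PosSemidef := by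
  simpa [r.posSemidef.isHermitian.eq] using posSemidef_conjTranspose_mul_self r.mat

/-- The signed sum `∑_j σ_j (-1)^{c_j} ρ_θ(x_j)` of the embedded data. -/
noncomputable def signedState {N : ℕ} (D : Fin N → Fin 2 × X) (σ : Fin N → ℤˣ) (θ : Θ) :
    Matrix n n ℂ :=
  ∑ j, (((labelSign (D j).1 * σ j : ℤˣ) : ℤ) : ℝ) • (ρ θ (D j).2).mat

theorem isHermitian_signedState {N : ℕ} (D : Fin N → Fin 2 × X) (σ : Fin N → ℤˣ) (θ : Θ) :
    (signedState ρ D σ θ).IsHermitian := by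
  rw [IsHermitian, signedState, conjTranspose_sum]
  refine Finset.sum_congr rfl fun j _ => ?_
  rw [conjTranspose_smul, (ρ θ (D j).2).posSemidef.isHermitian.eq, star_trivial]

/-- The second moment `∑_x p(x) ρ_θ(x)²`. -/
noncomputable def secondMoment [Fintype X] [MeasurableSpace X]
    (p : Measure (Fin 2 × X)) (θ : Θ) : Matrix n n ℂ :=
  ∑ x, (p.snd.real {x} : ℂ) • ((ρ θ x).mat * (ρ θ x).mat)

theorem posSemidef_secondMoment [Fintype X] [MeasurableSpace X]
    (p : Measure (Fin 2 × X)) (θ : Θ) : (secondMoment ρ p θ).PosSemidef :=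
  posSemidef_sum _ fun x _ => (ρ θ x).posSemidef_sq.smul (by exact_mod_cast measureReal_nonneg)

variable [DecidableEq n]

theorem signedLoss_eq {N : ℕ} (D : Fin N → Fin 2 × X) (σ : Fin N → ℤˣ) (θ : Θ) (M : POVM n) :
    signedLoss ρ D σ θ M = (∑ j, ((σ j : ℤ) : ℝ)) * (√(N : ℝ))⁻¹ / 2 -
      (√(N : ℝ))⁻¹ * (M.observable * signedState ρ D σ θ).trace.re / 2 := by
  simp only [signedLoss, signedState, Finset.mul_sum, trace_sum, Complex.re_sum, Finset.sum_mul,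
    Finset.sum_div, ← Finset.sum_sub_distrib, mul_smul_comm, trace_smul, Complex.smul_re,
    loss_eq_observable]
  refine Finset.sum_congr rfl fun j _ => ?_
  simp only [smul_eq_mul, Units.val_mul, Int.cast_mul]
  ring

theorem signedLoss_le {N : ℕ} (D : Fin N → Fin 2 × X) (σ : Fin N → ℤˣ) (θ : Θ) (M : POVM n)
    {Q : Matrix n n ℂ} (hQ : Q.PosDef) :
    signedLoss ρ D σ θ M ≤ (∑ j, ((σ j : ℤ) : ℝ)) * (√(N : ℝ))⁻¹ / 2 +
      (Q.trace.re + (Q⁻¹ * (signedState ρ D σ θ * signedState ρ D σ θ)).trace.re / N) / 4 := by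
  have hB : ((-(√(N : ℝ))⁻¹) • signedState ρ D σ θ).IsHermitian := by
    rw [IsHermitian, conjTranspose_smul, (isHermitian_signedState ρ D σ θ).eq, star_trivial]
  have h := two_mul_trace_mul_le_of_sq_le_one M.isHermitian_observable
    M.posSemidef_one_sub_observable_sq hB hQ
  simp only [mul_smul_comm, smul_mul_assoc, trace_smul, Complex.smul_re, smul_eq_mul] at h
  have hN : (√(N : ℝ))⁻¹ * (√(N : ℝ))⁻¹ = (N : ℝ)⁻¹ := by
    rw [← mul_inv, Real.mul_self_sqrt N.cast_nonneg]
  rw [← mul_assoc (-(√(N : ℝ))⁻¹), neg_mul_neg, hN] at h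
  rw [signedLoss_eq, div_eq_inv_mul _ (N : ℝ)]
  linarith

theorem trace_mul_signedState_sq {N : ℕ} (D : Fin N → Fin 2 × X) (σ : Fin N → ℤˣ) (θ : Θ)
    (A : Matrix n n ℂ) :
    (A * (signedState ρ D σ θ * signedState ρ D σ θ)).trace.re =
      ∑ j, ∑ k, (A * ((ρ θ (D j).2).mat * (ρ θ (D k).2).mat)).trace.re *
        (((((fun j => labelSign (D j).1) * σ) j : ℤˣ) : ℤ) : ℝ) *
          (((((fun j => labelSign (D j).1) * σ) k : ℤˣ) : ℤ) : ℝ) := by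
  rw [signedState, Finset.sum_mul_sum]
  simp only [Finset.mul_sum, trace_sum, Complex.re_sum,
    mul_smul_comm, smul_mul_assoc, trace_smul, Complex.smul_re, smul_eq_mul, Pi.mul_apply]
  refine Finset.sum_congr rfl fun j _ => Finset.sum_congr rfl fun k _ => ?_
  ring

/-- Since `Q` does not depend on the signs, AM-GM removes the supremum and leaves a quadratic form
in $\sigma$. Its mean keeps only the diagonal; label signs are absorbed by sign symmetry. -/
theorem signExpect_ciSup_signedLoss_le {N : ℕ} (D : Fin N → Fin 2 × X) (θ : Θ)
    {Q : Matrix n n ℂ} (hQ : Q.PosDef) :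
    signExpect N (fun σ => ⨆ M : POVM n, signedLoss ρ D σ θ M) ≤
      (Q.trace.re +
        (∑ j, (Q⁻¹ * ((ρ θ (D j).2).mat * (ρ θ (D j).2).mat)).trace.re) / N) / 4 := by
  set a : Fin N → Fin N → ℝ := fun j k =>
    (Q⁻¹ * ((ρ θ (D j).2).mat * (ρ θ (D k).2).mat)).trace.re with ha
  have h2 : signExpect N
      (fun σ => (Q⁻¹ * (signedState ρ D σ θ * signedState ρ D σ θ)).trace.re) = ∑ j, a j j := by
    rw [← signExpect_quadratic a, ← signExpect_mul_left (fun j => labelSign (D j).1)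
      (fun σ => ∑ j, ∑ k, a j k * (((σ j : ℤ) : ℝ) * ((σ k : ℤ) : ℝ)))]
    congr 1
    funext σ
    simp only [trace_mul_signedState_sq, ha, mul_assoc]
  refine (signExpect_mono (g := fun σ => ∑ j, ((√(N : ℝ))⁻¹ / 2) * ((σ j : ℤ) : ℝ) +
      (Q.trace.re / 4 + (4 * N : ℝ)⁻¹ *
        (Q⁻¹ * (signedState ρ D σ θ * signedState ρ D σ θ)).trace.re)) fun σ =>
      ciSup_le fun M => (signedLoss_le ρ D σ θ M hQ).trans_eq ?_).trans_eq ?_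
  · rw [← Finset.mul_sum, mul_inv]
    ring
  · rw [signExpect_add, signExpect_add, signExpect_sum, signExpect_const, signExpect_const_mul, h2]
    simp only [signExpect_const_mul, signExpect_sign, mul_zero, Finset.sum_const_zero, mul_inv]
    ring

variable [Fintype X] [MeasurableSpace X] (p : Measure (Fin 2 × X))

theorem trace_sqrt_secondMoment_nonneg (θ : Θ) :
    0 ≤ (CFC.sqrt (secondMoment ρ p θ)).trace.re :=
  (Complex.le_def.mp (CFC.sqrt_nonneg _).posSemidef.trace_nonneg).1

theorem sq_trace_sqrt_le_two_rpow_renyiMI (θ : Θ) :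
    (CFC.sqrt (secondMoment ρ p θ)).trace.re ^ 2 ≤ (2 : ℝ) ^ renyiMI p ρ θ := by
  have h := trace_sqrt_secondMoment_nonneg ρ p θ
  rcases h.eq_or_lt with h0 | h0
  · rw [← h0, zero_pow two_ne_zero]
    positivity
  · refine le_of_eq ?_
    rw [renyiMI, mul_comm, Real.rpow_mul zero_le_two]
    change _ = (2 ^ Real.logb 2 (CFC.sqrt (secondMoment ρ p θ)).trace.re) ^ (2 : ℝ)
    rw [Real.rpow_logb zero_lt_two (by norm_num) h0, Real.rpow_two]

variable [MeasurableSingletonClass X] [IsProbabilityMeasure p]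

theorem integral_snd_eq_sum (f : X → ℝ) : ∫ z, f z.2 ∂p = ∑ x, p.snd.real {x} * f x := by
  have h := integral_map (μ := p) (φ := Prod.snd) measurable_snd.aemeasurable
    (measurable_of_finite f).aestronglyMeasurable
  rw [← h]
  exact integral_fintype (μ := p.snd) Integrable.of_finite

theorem integral_trace_mul_sq (A : Matrix n n ℂ) (θ : Θ) :
    ∫ z, (A * ((ρ θ z.2).mat * (ρ θ z.2).mat)).trace.re ∂p =
      (A * secondMoment ρ p θ).trace.re := by
  rw [integral_snd_eq_sum p fun x => (A * ((ρ θ x).mat * (ρ θ x).mat)).trace.re]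
  simp [secondMoment, Finset.mul_sum, trace_sum, Complex.re_sum, trace_smul]

theorem trace_secondMoment_le_one (θ : Θ) : (secondMoment ρ p θ).trace.re ≤ 1 := by
  have h := integral_trace_mul_sq ρ p 1 θ
  rw [one_mul] at h
  rw [← h]
  refine (integral_mono Integrable.of_finite (integrable_const 1) fun z => ?_).trans_eq (by simp)
  simpa [(ρ θ z.2).trace_eq_one] using trace_sq_re_le_sq_trace (ρ θ z.2).posSemidef

theorem integral_signExpect_ciSup_signedLoss_le {N : ℕ} (hN : 0 < N) (θ : Θ) :
    ∫ D, signExpect N (fun σ => ⨆ M : POVM n, signedLoss ρ D σ θ M) ∂(iidLaw p N) ≤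
      1 / 2 * (CFC.sqrt (secondMoment ρ p θ)).trace.re := by
  have hN' : (0 : ℝ) < N := Nat.cast_pos.mpr hN
  set P := CFC.sqrt (secondMoment ρ p θ) with hPdef
  have hP : P.PosSemidef := (CFC.sqrt_nonneg _).posSemidef
  have hPP : P * P = secondMoment ρ p θ :=
    CFC.sqrt_mul_sqrt_self _ (posSemidef_secondMoment ρ p θ).nonneg
  refine le_of_forall_pos_le_add fun ε hε => ?_
  -- $\sqrt S$ may be singular, so $Q=\sqrt S+\eta$, with $\eta$ small enough that the extra trace
  -- is at most `ε`.
  set η : ℝ := ε / (Fintype.card n + 1) with hη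
  have hη0 : 0 < η := by positivity
  have hηε : η * Fintype.card n ≤ ε := by
    rw [hη, div_mul_eq_mul_div, div_le_iff₀ (by positivity)]
    nlinarith
  have hQ : (P + (η : ℂ) • 1).PosDef :=
    PosDef.posSemidef_add hP (PosDef.one.smul (by exact_mod_cast hη0))
  have hinv := trace_inv_add_smul_one_mul_sq_le hP hη0
  set Q := P + (η : ℂ) • 1
  have hQt : Q.trace.re = P.trace.re + η * Fintype.card n := by simp [Q]
  calc _ ≤ ∫ D, (Q.trace.re +
        (∑ j, (Q⁻¹ * ((ρ θ (D j).2).mat * (ρ θ (D j).2).mat)).trace.re) / N) / 4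
          ∂(iidLaw p N) := by
        unfold iidLaw
        exact integral_mono Integrable.of_finite Integrable.of_finite fun D =>
          signExpect_ciSup_signedLoss_le ρ D θ hQ
    _ = (Q.trace.re + (Q⁻¹ * (P * P)).trace.re) / 4 := by
        unfold iidLaw
        rw [integral_div, integral_add Integrable.of_finite Integrable.of_finite, integral_div,
          integral_finsetSum _ fun _ _ => Integrable.of_finite, hPP, ← integral_trace_mul_sq]
        simp only [integral_pi_comp_eval p
          fun z => (Q⁻¹ * ((ρ θ z.2).mat * (ρ θ z.2).mat)).trace.re]
        simp [hN'.ne']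
    _ ≤ 1 / 2 * P.trace.re + ε := by linarith

theorem trace_sqrt_secondMoment_le (θ : Θ) :
    (CFC.sqrt (secondMoment ρ p θ)).trace.re ≤ (1 + Fintype.card n) / 2 := by
  linarith [two_mul_trace_sqrt_le (posSemidef_secondMoment ρ p θ), trace_secondMoment_le_one ρ p θ]

/-- Uniformity in $\theta$ matters: an unbounded real supremum would default to $0$. The summand $1$
covers the default `logb 2 0 = 0`. -/
theorem two_rpow_renyiMI_le (θ : Θ) :
    (2 : ℝ) ^ renyiMI p ρ θ ≤ 1 + ((1 + Fintype.card n) / 2) ^ 2 := by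
  have h := trace_sqrt_secondMoment_nonneg ρ p θ
  have hle := trace_sqrt_secondMoment_le ρ p θ
  rw [renyiMI, mul_comm, Real.rpow_mul zero_le_two]
  change (2 ^ Real.logb 2 (CFC.sqrt (secondMoment ρ p θ)).trace.re) ^ (2 : ℝ) ≤ _
  rcases h.eq_or_lt with h0 | h0
  · rw [← h0]
    simp
    positivity
  · rw [Real.rpow_logb zero_lt_two (by norm_num) h0, Real.rpow_two]
    nlinarith

theorem bddAbove_two_rpow_renyiMI : BddAbove (Set.range fun θ => (2 : ℝ) ^ renyiMI p ρ θ) :=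
  ⟨_, by rintro _ ⟨θ, rfl⟩; exact two_rpow_renyiMI_le ρ p θ⟩

theorem bddAbove_integral_signExpect_ciSup_signedLoss {N : ℕ} (hN : 0 < N) :
    BddAbove (Set.range fun θ => ∫ D, signExpect N
      (fun σ => ⨆ M : POVM n, signedLoss ρ D σ θ M) ∂(iidLaw p N)) :=
  ⟨1 / 2 * ((1 + Fintype.card n) / 2), by
    rintro _ ⟨θ, rfl⟩
    exact (integral_signExpect_ciSup_signedLoss_le ρ p hN θ).trans
      (by gcongr; exact trace_sqrt_secondMoment_le ρ p θ)⟩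

/-- The Rademacher complexity of the POVMs is controlled by the 2-Rényi mutual information. -/
theorem radPOVM_le_renyiMI [Nonempty Θ] {N : ℕ} (hN : 0 < N) :
    radPOVM p ρ N ≤ 1 / 2 * √(⨆ θ : Θ, (2 : ℝ) ^ renyiMI p ρ θ) := by
  refine ciSup_le fun θ => (integral_signExpect_ciSup_signedLoss_le ρ p hN θ).trans ?_
  gcongr
  exact Real.le_sqrt_of_sq_le ((sq_trace_sqrt_le_two_rpow_renyiMI ρ p θ).trans
    (le_ciSup (bddAbove_two_rpow_renyiMI ρ p) θ))

end Renyi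

/-! ### Uniform deviations with high probability. -/

section UniformDeviation

theorem sum_le_sum_update_add {Z : Type*} {N : ℕ} {f : Z → ℝ} {c : ℝ}
    (hf : ∀ z z', f z ≤ f z' + c) (D : Fin N → Z) (k : Fin N) (z : Z) :
    ∑ j, f (D j) ≤ ∑ j, f (Function.update D k z j) + c := by
  have : ∑ j, f (D j) ≤ ∑ j, (f (Function.update D k z j) + if j = k then c else 0) := by
    refine Finset.sum_le_sum fun j _ => ?_
    by_cases h : j = k
    · subst h
      simpa using hf _ _
    · simp [h]
  simpa [Finset.sum_add_distrib] using this

variable {Z ι κ : Type*} [Fintype Z] [MeasurableSpace Z] [MeasurableSingletonClass Z]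
  (p : Measure Z) [IsProbabilityMeasure p]

theorem bddAbove_range_deviation {ℓ : ι → Z → ℝ} (hℓ : ∀ i z, |ℓ i z| ≤ 1) {N : ℕ}
    (D : Fin N → Z) : BddAbove (Set.range fun i => N * ∫ z, ℓ i z ∂p - ∑ j, ℓ i (D j)) := by
  refine ⟨N * 1 + ∑ _j : Fin N, (1 : ℝ), ?_⟩
  rintro _ ⟨i, rfl⟩
  have h1 : ∫ z, ℓ i z ∂p ≤ 1 :=
    (integral_mono Integrable.of_finite (integrable_const 1) fun z =>
      (abs_le.mp (hℓ i z)).2).trans_eq (by simp)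
  have h2 : ∑ j, -ℓ i (D j) ≤ ∑ _j : Fin N, (1 : ℝ) :=
    Finset.sum_le_sum fun j _ => by linarith [(abs_le.mp (hℓ i (D j))).1]
  rw [Finset.sum_neg_distrib] at h2
  dsimp only
  rw [sub_eq_add_neg]
  gcongr

theorem ciSup_deviation_update_le [Nonempty ι] {ℓ : ι → Z → ℝ} (hℓ : ∀ i z, |ℓ i z| ≤ 1)
    {c : ℝ} (hc : ∀ i z z', ℓ i z ≤ ℓ i z' + c) {N : ℕ} (D : Fin N → Z) (k : Fin N) (z : Z) :
    (⨆ i, (N * ∫ z, ℓ i z ∂p - ∑ j, ℓ i (Function.update D k z j))) ≤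
      (⨆ i, (N * ∫ z, ℓ i z ∂p - ∑ j, ℓ i (D j))) + c :=
  ciSup_le_ciSup_add (bddAbove_range_deviation p hℓ D) fun i => by
    linarith [sum_le_sum_update_add (hc i) D k z]

/-- Uniform deviation bound for the generalization gap of one class of `[0, 1]`-valued functions
plus the reverse gap of another one. -/
theorem measureReal_pi_deviation_le [Nonempty ι] [Nonempty κ] {ℓ₁ : ι → Z → ℝ} {ℓ₂ : κ → Z → ℝ}
    (h₁ : ∀ i z, ℓ₁ i z ∈ Set.Icc (0 : ℝ) 1) (h₂ : ∀ k z, ℓ₂ k z ∈ Set.Icc (0 : ℝ) 1)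
    {N : ℕ} (hN : 0 < N) {δ : ℝ} (hδ : 0 < δ) (hδ1 : δ ≤ 1) :
    (Measure.pi fun _ : Fin N => p).real {D | ∃ i k,
      2 * (rademacher p N ℓ₁ + rademacher p N ℓ₂) / N + √(2 / N * Real.log (1 / δ)) <
        (∫ z, ℓ₁ i z ∂p - (∑ j, ℓ₁ i (D j)) / N) +
          ((∑ j, ℓ₂ k (D j)) / N - ∫ z, ℓ₂ k z ∂p)} ≤ δ := by
  have hN' : (0 : ℝ) < N := Nat.cast_pos.mpr hN
  have a₁ : ∀ i z, |ℓ₁ i z| ≤ 1 := fun i z =>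
    abs_le.mpr ⟨by linarith [(h₁ i z).1], (h₁ i z).2⟩
  have a₂ : ∀ k z, |-ℓ₂ k z| ≤ 1 := fun k z =>
    abs_le.mpr ⟨by linarith [(h₂ k z).2], by linarith [(h₂ k z).1]⟩
  set μ : Measure (Fin N → Z) := Measure.pi fun _ => p with hμ
  let g₁ : (Fin N → Z) → ℝ := fun D => ⨆ i, (N * ∫ z, ℓ₁ i z ∂p - ∑ j, ℓ₁ i (D j))
  let g₂ : (Fin N → Z) → ℝ := fun D => ⨆ k, (N * ∫ z, -ℓ₂ k z ∂p - ∑ j, -ℓ₂ k (D j))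
  have hE : ∫ D, (g₁ D + g₂ D) ∂μ ≤ 2 * (rademacher p N ℓ₁ + rademacher p N ℓ₂) := by
    have e₂ := integral_ciSup_sub_le_rademacher p (N := N) a₂
    rw [rademacher_neg] at e₂
    rw [integral_add Integrable.of_finite Integrable.of_finite, mul_add]
    exact add_le_add (integral_ciSup_sub_le_rademacher p a₁) e₂
  -- Each supremum moves by at most 1. Treating the sum at once spends the confidence level only
  -- once.
  have hbd : ∀ D k z, (g₁ + g₂) (Function.update D k z) ≤ (g₁ + g₂) D + 2 := fun D k z => by
    have b₁ := ciSup_deviation_update_le p a₁ (c := 1)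
      (fun i z z' => by linarith [(h₁ i z).2, (h₁ i z').1]) D k z
    have b₂ := ciSup_deviation_update_le p a₂ (c := 1)
      (fun i z z' => by linarith [(h₂ i z').2, (h₂ i z).1]) D k z
    simp only [Pi.add_apply, g₁, g₂]
    linarith
  have hlog : 0 ≤ 2 / N * Real.log (1 / δ) := by
    have := Real.log_nonneg (one_le_one_div hδ hδ1)
    positivity
  set s := √(2 / N * Real.log (1 / δ)) with hs
  have hs2 : s ^ 2 = 2 / N * Real.log (1 / δ) := Real.sq_sqrt hlog
  have hmc := measureReal_pi_ge_le_of_bounded_differences p (ε := N * s) (by positivity) hbd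
  -- The deviations are not divided by $N$, so the threshold is $Ns$ and the exponent is $-Ns^2/2$.
  have hexp : -(2 * (N * s) ^ 2) / (N * 2 ^ 2) = Real.log δ := by
    rw [mul_pow, hs2, one_div, Real.log_inv]
    field_simp
  rw [hexp, Real.exp_log hδ] at hmc
  refine (measureReal_mono ?_).trans hmc
  rintro D ⟨i, k, h⟩
  have b₁ : N * ∫ z, ℓ₁ i z ∂p - ∑ j, ℓ₁ i (D j) ≤ g₁ D :=
    le_ciSup (bddAbove_range_deviation p a₁ D) i
  have b₂ : N * ∫ z, -ℓ₂ k z ∂p - ∑ j, -ℓ₂ k (D j) ≤ g₂ D :=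
    le_ciSup (bddAbove_range_deviation p a₂ D) k
  rw [integral_neg, Finset.sum_neg_distrib] at b₂
  have h' := mul_lt_mul_of_pos_left h hN'
  have e : ∀ x : ℝ, (N : ℝ) * (x / N) = x := fun x => by field_simp
  rw [mul_add (N : ℝ), mul_add (N : ℝ), mul_sub (N : ℝ), mul_sub (N : ℝ), e, e, e] at h'
  change ∫ D, (g₁ D + g₂ D) ∂μ + N * s ≤ g₁ D + g₂ D
  linarith

end UniformDeviation

/-! ### Risk bounds for the two training stages. -/

section Transfer

variable {n X Θ : Type*} [Fintype n] [DecidableEq n] (ρ : Θ → X → DensityMatrix n)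

theorem integral_signExpect_ciSup_div_sqrt {Z ι : Type*} [MeasurableSpace Z] (p : Measure Z)
    (N : ℕ) (ℓ : ι → Z → ℝ) :
    ∫ D, signExpect N (fun σ => ⨆ i, ∑ j, ((σ j : ℤ) : ℝ) * ℓ i (D j) / √(N : ℝ))
      ∂(Measure.pi fun _ => p) = rademacher p N ℓ / √(N : ℝ) := by
  unfold rademacher
  rw [← integral_div]
  refine integral_congr_ae (ae_of_all _ fun D => ?_)
  simp only [div_eq_inv_mul _ √(N : ℝ), ← Finset.mul_sum]
  rw [← signExpect_const_mul]
  simp only [Real.mul_iSup_of_nonneg (inv_nonneg.mpr (Real.sqrt_nonneg (N : ℝ)))]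

theorem bddBelow_range_empRisk {N : ℕ} (D : Fin N → Fin 2 × X) (θ : Θ) :
    BddBelow (Set.range fun M : POVM n => empRisk D ρ θ M) :=
  ⟨0, by
    rintro _ ⟨M, rfl⟩
    exact div_nonneg (Finset.sum_nonneg fun j _ => loss_nonneg ρ θ M _) N.cast_nonneg⟩

variable [MeasurableSpace X]

instance (p : Measure (Fin 2 × X)) [IsProbabilityMeasure p] (N : ℕ) :
    IsProbabilityMeasure (iidLaw p N) :=
  inferInstanceAs (IsProbabilityMeasure (Measure.pi _))

theorem radJoint_eq (p : Measure (Fin 2 × X)) (N : ℕ) :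
    radJoint p ρ N = rademacher p N (fun q : Θ × POVM n => loss ρ q.1 q.2) / √(N : ℝ) :=
  integral_signExpect_ciSup_div_sqrt p N _

theorem bddBelow_range_risk (p : Measure (Fin 2 × X)) (θ : Θ) :
    BddBelow (Set.range fun M : POVM n => risk p ρ θ M) :=
  ⟨0, by rintro _ ⟨M, rfl⟩; exact integral_nonneg fun z => loss_nonneg ρ θ M z⟩

variable [Fintype X] [MeasurableSingletonClass X] (p : Measure (Fin 2 × X))
  [IsProbabilityMeasure p]

theorem rademacher_div_le_radPOVM {N : ℕ} (hN : 0 < N) (θ : Θ) :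
    rademacher p N (loss ρ θ) / √(N : ℝ) ≤ radPOVM p ρ N := by
  rw [← integral_signExpect_ciSup_div_sqrt]
  exact le_ciSup (bddAbove_integral_signExpect_ciSup_signedLoss ρ p hN) θ

theorem div_natCast_eq_div_sqrt_div_sqrt (a : ℝ) (N : ℕ) :
    a / N = a / √(N : ℝ) / √(N : ℝ) := by
  rw [div_div, Real.mul_self_sqrt N.cast_nonneg]

/-- Training the POVM on the target data. -/
theorem measureReal_target_le {N : ℕ} (hN : 0 < N) (θ : Θ) (Mhat : (Fin N → Fin 2 × X) → POVM n)
    (hM : ∀ D, IsMinOn (empRisk D ρ θ) Set.univ (Mhat D)) {δ : ℝ} (hδ : 0 < δ) (hδ1 : δ ≤ 1) :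
    (iidLaw p N).real {D | minRisk p ρ θ + 4 * radPOVM p ρ N / √(N : ℝ) +
      √(2 / N * Real.log (1 / δ)) < risk p ρ θ (Mhat D)} ≤ δ := by
  refine (measureReal_mono (μ := iidLaw p N) ?_).trans (measureReal_pi_deviation_le p
    (ℓ₁ := loss ρ θ)
    (ℓ₂ := loss ρ θ) (fun M z => ⟨loss_nonneg ρ θ M z, loss_le_one ρ θ M z⟩)
    (fun M z => ⟨loss_nonneg ρ θ M z, loss_le_one ρ θ M z⟩) hN hδ hδ1)
  intro D hD
  by_contra hcon
  simp only [Set.mem_ofPred_eq, not_exists, not_lt] at hD hcon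
  refine absurd hD (not_lt.mpr ?_)
  -- Both classes are the POVMs at the same $\theta$, which gives the constant $4=2(1+1)$.
  have hrad : 2 * (rademacher p N (loss ρ θ) + rademacher p N (loss ρ θ)) / N ≤
      4 * radPOVM p ρ N / √(N : ℝ) := by
    rw [div_natCast_eq_div_sqrt_div_sqrt]
    gcongr
    rw [← two_mul, ← mul_assoc, mul_div_assoc]
    norm_num
    exact rademacher_div_le_radPOVM ρ p hN θ
  suffices risk p ρ θ (Mhat D) - (4 * radPOVM p ρ N / √(N : ℝ) + √(2 / N * Real.log (1 / δ))) ≤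
      minRisk p ρ θ by linarith
  refine le_ciInf fun M => ?_
  have h1 : empRisk D ρ θ (Mhat D) ≤ empRisk D ρ θ M := hM D (Set.mem_univ M)
  have h2 := hcon (Mhat D) M
  unfold empRisk at h1
  unfold risk
  linarith

/-- Pre-training the embedding on the source data. -/
theorem measureReal_source_le {N : ℕ} (hN : 0 < N) (θS : Θ) (θhat : (Fin N → Fin 2 × X) → Θ)
    (hθ : ∀ D, IsMinOn (minEmpRisk D ρ) Set.univ (θhat D)) {δ : ℝ} (hδ : 0 < δ) (hδ1 : δ ≤ 1) :
    (iidLaw p N).real {D | minRisk p ρ θS + 2 * (radJoint p ρ N + radPOVM p ρ N) / √(N : ℝ) +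
      √(2 / N * Real.log (1 / δ)) < minRisk p ρ (θhat D)} ≤ δ := by
  have : Nonempty Θ := ⟨θS⟩
  refine (measureReal_mono (μ := iidLaw p N) ?_).trans (measureReal_pi_deviation_le p
    (ℓ₁ := fun q : Θ × POVM n => loss ρ q.1 q.2) (ℓ₂ := loss ρ θS)
    (fun q z => ⟨loss_nonneg ρ _ _ z, loss_le_one ρ _ _ z⟩)
    (fun M z => ⟨loss_nonneg ρ θS M z, loss_le_one ρ θS M z⟩) hN hδ hδ1)
  intro D hD
  by_contra hcon
  simp only [Set.mem_ofPred_eq, not_exists, not_lt] at hD hcon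
  refine absurd hD (not_lt.mpr ?_)
  set s := √(2 / N * Real.log (1 / δ))
  have hrad : 2 * (rademacher p N (fun q : Θ × POVM n => loss ρ q.1 q.2) +
      rademacher p N (loss ρ θS)) / N ≤ 2 * (radJoint p ρ N + radPOVM p ρ N) / √(N : ℝ) := by
    rw [div_natCast_eq_div_sqrt_div_sqrt, radJoint_eq, mul_div_assoc, add_div]
    gcongr
    exact rademacher_div_le_radPOVM ρ p hN θS
  set B := 2 * (radJoint p ρ N + radPOVM p ρ N) / √(N : ℝ)
  -- Comparing with every POVM at $\theta_*^S$ avoids having to show that the minimal risk is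
  -- attained.
  suffices ∀ M, minRisk p ρ (θhat D) - (B + s) ≤ risk p ρ θS M by
    have := le_ciInf this
    change _ ≤ minRisk p ρ θS at this
    linarith
  intro M
  have h1 : minEmpRisk D ρ (θhat D) ≤ empRisk D ρ θS M :=
    (hθ D (Set.mem_univ θS)).trans (ciInf_le (bddBelow_range_empRisk ρ D θS) M)
  have h2 : minRisk p ρ (θhat D) - (B + s) + (empRisk D ρ θS M - risk p ρ θS M) ≤
      minEmpRisk D ρ (θhat D) := by
    refine le_ciInf fun M' => ?_
    have h3 : minRisk p ρ (θhat D) ≤ risk p ρ (θhat D) M' :=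
      ciInf_le (bddBelow_range_risk ρ p (θhat D)) M'
    have h4 := hcon (θhat D, M') M
    unfold empRisk
    unfold risk at h3 ⊢
    linarith
  linarith

end Transfer

/-! ### Conditioning on the source data. -/

section Product

variable {α β : Type*} [MeasurableSpace α] [MeasurableSpace β]

theorem measureReal_prod_le_of_forall_measureReal_le (μ : Measure α) (ν : Measure β)
    [IsProbabilityMeasure μ] [IsProbabilityMeasure ν] {s : Set (α × β)} (hs : MeasurableSet s)
    {ε : ℝ} (hε : 0 ≤ ε) (h : ∀ a, ν.real (Prod.mk a ⁻¹' s) ≤ ε) : (μ.prod ν).real s ≤ ε := by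
  refine ENNReal.toReal_le_of_le_ofReal hε ?_
  rw [Measure.prod_apply hs]
  refine (lintegral_mono (g := fun _ => ENNReal.ofReal ε) fun a => ?_).trans_eq (by simp)
  exact (ENNReal.le_ofReal_iff_toReal_le (measure_ne_top _ _) hε).mpr (h a)

end Product

end QTransfer

/-! ### Assembly of the transfer bound. -/

theorem mainTheorem1
    {n X Θ : Type*} [Fintype n] [DecidableEq n]
    [Fintype X] [MeasurableSpace X] [MeasurableSingletonClass X]
    (pS pT : Measure (Fin 2 × X)) [IsProbabilityMeasure pS] [IsProbabilityMeasure pT]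
    (ρ : Θ → X → DensityMatrix n)
    (NS NT : ℕ) (hNS : 0 < NS) (hNT : 0 < NT)
    -- optimal embedding parameters of the source and of the target task
    (θS θT : Θ)
    (hθS : IsMinOn (minRisk pS ρ) Set.univ θS)
    (hθT : IsMinOn (minRisk pT ρ) Set.univ θT)
    -- pre-training: the embedding parameter minimizes the source training loss
    (θhat : (Fin NS → Fin 2 × X) → Θ)
    (hθhat : ∀ DS, IsMinOn (minEmpRisk DS ρ) Set.univ (θhat DS))
    -- training: for each embedding parameter, the POVM minimizes the target training loss
    (Mhat : Θ → (Fin NT → Fin 2 × X) → POVM n)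
    (hMhat : ∀ θ DT, IsMinOn (empRisk DT ρ θ) Set.univ (Mhat θ DT))
    (DST : ℝ) (hDST : Dissimilar pS pT ρ θS θT DST)
    (δ : ℝ) (hδ : δ ∈ Set.Ioo (0 : ℝ) 1) :
    1 - δ ≤ ((iidLaw pS NS).prod (iidLaw pT NT)).real
        {D | transferExcess pT ρ (θhat D.1) (Mhat (θhat D.1) D.2) ≤
            4 * radPOVM pT ρ NT / √(NT : ℝ) + √(2 / NT * Real.log (3 / δ)) + DST
              + 2 * (radJoint pS ρ NS + radPOVM pS ρ NS) / √(NS : ℝ)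
              + √(2 / NS * Real.log (3 / δ))} ∧
      radPOVM pS ρ NS ≤ 1 / 2 * √(⨆ θ : Θ, (2 : ℝ) ^ renyiMI pS ρ θ) ∧
      radPOVM pT ρ NT ≤ 1 / 2 * √(⨆ θ : Θ, (2 : ℝ) ^ renyiMI pT ρ θ) := by
  have : Nonempty Θ := ⟨θS⟩
  refine ⟨?_, radPOVM_le_renyiMI ρ pS hNS, radPOVM_le_renyiMI ρ pT hNT⟩
  obtain ⟨hδ0, hδ1⟩ := hδ
  -- Only two bad events occur, so the total failure probability is at most $2\delta/3$.
  have hδ3 : 0 < δ / 3 := by positivity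
  have hδ31 : δ / 3 ≤ 1 := by linarith
  set good : Set ((Fin NS → Fin 2 × X) × (Fin NT → Fin 2 × X)) := {D | _} with hgood
  have hsrc := measureReal_source_le ρ pS hNS θS θhat hθhat hδ3 hδ31
  set A : Set (Fin NS → Fin 2 × X) := {D | _} with hA
  let C : Set ((Fin NS → Fin 2 × X) × (Fin NT → Fin 2 × X)) :=
    {D | minRisk pT ρ (θhat D.1) + 4 * radPOVM pT ρ NT / √(NT : ℝ) +
      √(2 / NT * Real.log (1 / (δ / 3))) < risk pT ρ (θhat D.1) (Mhat (θhat D.1) D.2)}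
  -- For fixed source data, $\hat\theta$ is a constant, and the target bound applies to each slice.
  have hC : ((iidLaw pS NS).prod (iidLaw pT NT)).real C ≤ δ / 3 :=
    measureReal_prod_le_of_forall_measureReal_le _ _ (Set.toFinite C).measurableSet hδ3.le
      fun D => measureReal_target_le ρ pT hNT (θhat D) (Mhat (θhat D)) (hMhat (θhat D)) hδ3 hδ31
  have hA' : ((iidLaw pS NS).prod (iidLaw pT NT)).real (A ×ˢ Set.univ) ≤ δ / 3 := by
    rw [measureReal_prod_prod, probReal_univ, mul_one]
    exact hsrc
  have hsub : goodᶜ ⊆ A ×ˢ Set.univ ∪ C := by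
    intro D hD
    by_contra hcon
    refine hD ?_
    simp only [Set.mem_union, Set.mem_prod, Set.mem_univ, and_true, not_or] at hcon
    obtain ⟨h1, h2⟩ := hcon
    simp only [hA, C, Set.mem_ofPred_eq, not_lt, one_div_div] at h1 h2
    have hmin : minRisk pT ρ θT ≤ ⨅ θ', minRisk pT ρ θ' :=
      le_ciInf fun θ => hθT (Set.mem_univ θ)
    have h3 := hDST (θhat D.1)
    have h4 : minRisk pS ρ θS ≤ minRisk pS ρ (θhat D.1) := hθS (Set.mem_univ _)
    rw [taskDist, taskDist, abs_sub_comm (minRisk pS ρ θS), abs_of_nonneg (sub_nonneg.mpr h4)] at h3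
    have h5 := neg_abs_le (minRisk pT ρ θT - minRisk pT ρ (θhat D.1))
    simp only [hgood, Set.mem_ofPred_eq, transferExcess]
    linarith
  have hle := (measureReal_mono (μ := (iidLaw pS NS).prod (iidLaw pT NT)) hsub).trans
    (measureReal_union_le _ _)
  rw [probReal_compl_eq_one_sub (Set.toFinite good).measurableSet] at hle
  linarith
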